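/- Let $D\subset\mathbb{R}^2$ be a bounded open set and let $f_1,f_2:\overline{D}\to\mathbb{R}$ be smooth functions. For $j=1,2$ let $\hat f_j(x_1,x_2)=(x_1,x_2,f_j(x_1,x_2))$ be the graph of $f_j$ in $\mathbb{R}^3$ over $\overline{D}$, oriented by its upward-pointing unit normal, and let its mean curvature be half the trace of its shape operator with respect to this normal. Suppose that there is a constant $H\in\mathbb{R}$ such that both $\hat f_1$ and $\hat f_2$ have mean curvature identically equal to $H$ (the same $H$ for both graphs) over the interior of $\overline{D}$. Suppose further that 1. $\hat f_1$ lies above $\hat f_2$, that is, $f_1\ge f_2$ on $\overline{D}$; 2. $p=\hat f_1(x)=\hat f_2(x)$ for some point $x$ in the interior of $\overline{D}$. (The tangent planes of the two graphs at $p$ then coincide automatically.) Then $\hat f_1$ and $\hat f_2$ coincide in a neighbourhood of $p$: there is an open set $U\subset\mathbb{R}^3$ containing $p$ such that $\hat f_1(\overline{D})\cap U=\hat f_2(\overline{D})\cap U$. -/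

import Mathlib

open Set Topology
open scoped ContDiff

noncomputable section

namespace CMCGraph

/-- The Euclidean plane with coordinates `x 0, x 1`. -/
abbrev Plane : Type := EuclideanSpace ℝ (Fin 2)

/-- Euclidean three-space with coordinates `p 0, p 1, p 2`. -/
abbrev Space : Type := EuclideanSpace ℝ (Fin 3)

/-- The partial derivative of `F` with respect to the `i`-th coordinate of the plane. -/
def partialDeriv {E : Type*} [NormedAddCommGroup E] [NormedSpace ℝ E]
    (i : Fin 2) (F : Plane → E) (x : Plane) : E :=
  fderiv ℝ F x (EuclideanSpace.single i 1)

/-- The matrix `g i j = ⟨∂ᵢ F, ∂ⱼ F⟩` of the first fundamental form of `F`. -/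
def firstFundamentalForm (F : Plane → Space) (x : Plane) : Matrix (Fin 2) (Fin 2) ℝ :=
  Matrix.of fun i j => inner ℝ (partialDeriv i F x) (partialDeriv j F x)

/-- The matrix `b i j = ⟨∂ⱼ ∂ᵢ F, N⟩` of the second fundamental form of `F`
with respect to the unit normal field `N`. -/
def secondFundamentalForm (F N : Plane → Space) (x : Plane) : Matrix (Fin 2) (Fin 2) ℝ :=
  Matrix.of fun i j => inner ℝ (partialDeriv j (partialDeriv i F) x) (N x)

/-- The matrix `g⁻¹ b` of the shape operator of the immersion `F` with unit normal field `N`. -/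
def shapeOperator (F N : Plane → Space) (x : Plane) : Matrix (Fin 2) (Fin 2) ℝ :=
  (firstFundamentalForm F x)⁻¹ * secondFundamentalForm F N x

/-- The mean curvature: half the trace of the shape operator. -/
def meanCurvature (F N : Plane → Space) (x : Plane) : ℝ :=
  (shapeOperator F N x).trace / 2

/-- The graph map `x ↦ (x₁, x₂, f (x₁, x₂))`. -/
def graphMap (f : Plane → ℝ) (x : Plane) : Space :=
  !₂[x 0, x 1, f x]

/-- The upward pointing unit normal field of the graph of `f`. -/
def upwardNormal (f : Plane → ℝ) (x : Plane) : Space :=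
  (Real.sqrt (1 + partialDeriv 0 f x ^ 2 + partialDeriv 1 f x ^ 2))⁻¹ •
    !₂[-partialDeriv 0 f x, -partialDeriv 1 f x, 1]

/-- The graph of `f` over the closed domain `closure D`, as a subset of three-space. -/
def graphSurface (D : Set Plane) (f : Plane → ℝ) : Set Space :=
  graphMap f '' closure D

/-- The graph of `f` over `closure D` is a smooth surface of constant mean curvature `H` with
respect to its upward pointing normal. The values of `f` off `closure D` play no role. -/
structure IsCMCGraph (D : Set Plane) (H : ℝ) (f : Plane → ℝ) : Prop where
  smooth : ContDiffOn ℝ ∞ f (closure D)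
  meanCurvature_eq : ∀ x ∈ interior (closure D),
    meanCurvature (graphMap f) (upwardNormal f) x = H

/-- The graph of `f₁` over `closure D` lies above the graph of `f₂`. -/
def LiesAbove (D : Set Plane) (f₁ f₂ : Plane → ℝ) : Prop :=
  ∀ x ∈ closure D, f₂ x ≤ f₁ x

/-- `p` is an interior point of common tangency: a common point of the two graphs
over an interior point of `closure D`. When one graph lies above the other
the tangent planes at such a point coincide automatically, so this is not assumed. -/
def IsInteriorCommonTangency (D : Set Plane) (f₁ f₂ : Plane → ℝ) (p : Space) : Prop :=
  ∃ x ∈ interior (closure D), p = graphMap f₁ x ∧ p = graphMap f₂ x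

end CMCGraph

end

/-! In terms of the rotated gradient ν = (∂₁f, -∂₀f) and W = √(1 + |ν|²), the mean curvature
equation reads Δf + D²f(ν,ν) = 2HW³ (`meanCurvature_graph_equation`). For w = f₁ - f₂ ≥ 0,
subtracting the two equations leaves Δw + D²w(ν₁,ν₁) on one side. The other side is a difference of
W³ terms plus D²f₂(ν₂,ν₂) - D²f₂(ν₁,ν₁), and near the contact point both are at most a constant
times |Dw| (`curvature_difference_le`). Thus w is a nonnegative supersolution of an elliptic
inequality with an interior zero.

Hopf's strong maximum principle (`supersolution_eventually_eq_zero`) then makes w vanish near that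
zero. Otherwise some ball free of zeros would touch the zero set at a boundary point, and comparison
with an exponential barrier would force w > 0 there. The second-order operator is kept as a sum of
squares of directions ξ k, so no coefficient matrix is needed. -/

namespace CMCGraph

/-! ### Hopf's strong maximum principle -/

section MaximumPrinciple

variable {E : Type*} [NormedAddCommGroup E]

/-- At a local minimum of a `C²` function the Hessian is positive semidefinite. -/
theorem hessian_nonneg_of_isLocalMin [NormedSpace ℝ E] {w : E → ℝ} {q : E} (hw : ContDiffAt ℝ 2 w q)
    (hmin : IsLocalMin w q) (v : E) : 0 ≤ fderiv ℝ (fderiv ℝ w) q v v := by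
  by_contra! hneg
  have hline : ∀ t : ℝ, HasDerivAt (fun t : ℝ => q + t • v) v t := fun t => by
    simpa using ((hasDerivAt_id t).smul_const v).const_add q
  have hcont : Filter.Tendsto (fun t : ℝ => q + t • v) (𝓝 0) (𝓝 q) := by
    simpa using (hline 0).continuousAt.tendsto
  have hd : ∀ᶠ x in 𝓝 q, DifferentiableAt ℝ w x := by
    filter_upwards [hw.eventually (by simp)] with x hx using hx.differentiableAt (by simp)
  have hderiv : deriv (fun t : ℝ => w (q + t • v)) =ᶠ[𝓝 0] fun t => fderiv ℝ w (q + t • v) v := by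
    filter_upwards [hcont.eventually hd] with t ht
    exact (ht.hasFDerivAt.comp_hasDerivAt t (hline t)).deriv
  have hd2 : DifferentiableAt ℝ (fderiv ℝ w) q :=
    (hw.fderiv_right (m := 1) (by norm_num)).differentiableAt (by simp)
  have hsecond : deriv (deriv fun t : ℝ => w (q + t • v)) 0 = fderiv ℝ (fderiv ℝ w) q v v := by
    rw [hderiv.deriv_eq]
    have h1 : HasFDerivAt (fderiv ℝ w) (fderiv ℝ (fderiv ℝ w) q) (q + (0 : ℝ) • v) := by
      simpa using hd2.hasFDerivAt
    have h2 : HasDerivAt (fun t : ℝ => fderiv ℝ w (q + t • v)) (fderiv ℝ (fderiv ℝ w) q v) 0 :=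
      h1.comp_hasDerivAt (0 : ℝ) (hline 0)
    simpa using (h2.clm_apply (hasDerivAt_const (0 : ℝ) v)).deriv
  have hmin0 : IsLocalMin (fun t : ℝ => w (q + t • v)) 0 := by
    have := hcont.eventually hmin
    filter_upwards [this] with t ht using by simpa using ht
  -- A negative second derivative would make 0 a local maximum as well, so w would be constant along
  -- the line near q and its second derivative zero.
  have hmax0 : IsLocalMax (fun t : ℝ => w (q + t • v)) 0 := by
    refine isLocalMax_of_deriv_deriv_neg (hsecond ▸ hneg) hmin0.deriv_eq_zero ?_
    have : ContinuousAt w (q + (0 : ℝ) • v) := by simpa using hw.continuousAt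
    exact ContinuousAt.comp (f := fun t : ℝ => q + t • v) this (hline 0).continuousAt
  have hconst : (fun t : ℝ => w (q + t • v)) =ᶠ[𝓝 0] fun _ => w q := by
    filter_upwards [hmin0, hmax0] with t h1 h2
    exact le_antisymm (by simpa using h2) (by simpa using h1)
  have : deriv (deriv fun t : ℝ => w (q + t • v)) 0 = 0 := by
    rw [hconst.deriv.deriv_eq]; simp
  linarith [hsecond]

variable [InnerProductSpace ℝ E]

/-- The Hopf barrier centred at `y`. -/
noncomputable def barrier (ε α r : ℝ) (y x : E) : ℝ :=
  ε * (Real.exp (-α * ‖x - y‖ ^ 2) - Real.exp (-α * r ^ 2))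

theorem contDiff_barrier (ε α r : ℝ) (y : E) {n : WithTop ℕ∞} : ContDiff ℝ n (barrier ε α r y) := by
  unfold barrier
  exact contDiff_const.mul (((contDiff_const.mul
    ((contDiff_id.sub contDiff_const).norm_sq ℝ)).exp).sub contDiff_const)

theorem fderiv_barrier (ε α r : ℝ) (y x : E) :
    fderiv ℝ (barrier ε α r y) x =
      (-2 * ε * α * Real.exp (-α * ‖x - y‖ ^ 2)) • innerSL ℝ (x - y) := by
  have h : HasFDerivAt (fun x : E => ‖x - y‖ ^ 2) (2 • innerSL ℝ (x - y)) x := by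
    simpa using ((hasFDerivAt_id x).sub_const y).norm_sq
  have := (((h.const_mul (-α)).exp).sub_const (Real.exp (-α * r ^ 2))).const_mul ε
  refine this.fderiv.trans ?_
  ext v
  simp
  ring

/-- The α² term sees only the radial component of v; away from the centre, ellipticity lets it
dominate the term linear in α once α is large. -/
theorem hessian_barrier (ε α r : ℝ) (y x v : E) :
    fderiv ℝ (fderiv ℝ (barrier ε α r y)) x v v =
      ε * Real.exp (-α * ‖x - y‖ ^ 2) * (4 * α ^ 2 * inner ℝ (x - y) v ^ 2 - 2 * α * ‖v‖ ^ 2) := by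
  have h : HasFDerivAt (fun x : E => ‖x - y‖ ^ 2) (2 • innerSL ℝ (x - y)) x := by
    simpa using ((hasFDerivAt_id x).sub_const y).norm_sq
  have h1 := ((h.const_mul (-α)).exp).const_mul (-2 * ε * α)
  have h2 : HasFDerivAt (fun x : E => innerSL ℝ (x - y)) (innerSL ℝ : E →L[ℝ] E →L[ℝ] ℝ) x :=
    (innerSL ℝ : E →L[ℝ] E →L[ℝ] ℝ).hasFDerivAt.comp x ((hasFDerivAt_id x).sub_const y)
  rw [funext (fderiv_barrier ε α r y)]
  refine (congrArg (fun A : E →L[ℝ] E →L[ℝ] ℝ => A v v) (h1.smul h2).fderiv).trans ?_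
  have hv : innerSL ℝ v v = ‖v‖ ^ 2 := real_inner_self_eq_norm_sq v
  simp [inner_sub_left, hv]
  ring

/-- The barrier is a strict subsolution away from its centre. -/
theorem barrier_subsolution {ι : Type*} [Fintype ι] {ε α r C M ρ : ℝ} (hε : 0 < ε) (hα : 0 < α)
    (hρ : 0 < ρ) (hC : 0 ≤ C) (y x : E) (ξ : ι → E)
    (hell : ‖x - y‖ ^ 2 ≤ ∑ k, inner ℝ (x - y) (ξ k) ^ 2) (hbd : ∑ k, ‖ξ k‖ ^ 2 ≤ M)
    (hlow : ρ ≤ ‖x - y‖) (hup : ‖x - y‖ ≤ 3 * ρ) (hαbig : M + 3 * C * ρ < 2 * α * ρ ^ 2) :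
    C * ‖fderiv ℝ (barrier ε α r y) x‖ <
      ∑ k, fderiv ℝ (fderiv ℝ (barrier ε α r y)) x (ξ k) (ξ k) := by
  simp only [hessian_barrier, fderiv_barrier, norm_smul, innerSL_apply_norm]
  rw [← Finset.mul_sum, Finset.sum_sub_distrib, ← Finset.mul_sum, ← Finset.mul_sum]
  have he := Real.exp_pos (-α * ‖x - y‖ ^ 2)
  set e := Real.exp (-α * ‖x - y‖ ^ 2)
  have hn : ‖-2 * ε * α * e‖ = ε * e * (2 * α) := by
    rw [Real.norm_eq_abs, show -2 * ε * α * e = -(ε * e * (2 * α)) by ring, abs_neg,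
      abs_of_pos (by positivity)]
  rw [hn]
  have h1 : C * ‖x - y‖ ≤ 3 * C * ρ := by nlinarith
  have h2 : ρ ^ 2 ≤ ‖x - y‖ ^ 2 := by gcongr
  -- After removing the common factor ε * e * (2 * α), this is exactly the largeness condition
  -- `hαbig`.
  have h3 : C * (2 * α * ‖x - y‖) <
      4 * α ^ 2 * ∑ k, inner ℝ (x - y) (ξ k) ^ 2 - 2 * α * ∑ k, ‖ξ k‖ ^ 2 := by
    have h4 : 2 * α * ρ ^ 2 ≤ 2 * α * ∑ k, inner ℝ (x - y) (ξ k) ^ 2 := by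
      gcongr; exact h2.trans hell
    have := mul_lt_mul_of_pos_left
      (show C * ‖x - y‖ + ∑ k, ‖ξ k‖ ^ 2 < 2 * α * ∑ k, inner ℝ (x - y) (ξ k) ^ 2 by linarith)
      (show (0 : ℝ) < 2 * α by positivity)
    linarith
  have := mul_lt_mul_of_pos_left h3 (show 0 < ε * e by positivity)
  linarith

/-- A nonnegative supersolution near a boundary point `z` of a ball is positive at `z` if it is
positive on the rest of the closed ball. -/
theorem supersolution_pos_of_touching_ball [FiniteDimensional ℝ E] {ι : Type*} [Fintype ι]
    {u : E → ℝ} {ξ : ι → E → E} {C M ρ : ℝ} {y z : E} (hρ : 0 < ρ) (hC : 0 ≤ C)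
    (hu : ∀ x ∈ Metric.closedBall z ρ, ContDiffAt ℝ 2 u x)
    (hnn : ∀ x ∈ Metric.closedBall z ρ, 0 ≤ u x)
    (hell : ∀ x ∈ Metric.closedBall z ρ, ∀ v : E, ‖v‖ ^ 2 ≤ ∑ k, inner ℝ v (ξ k x) ^ 2)
    (hbd : ∀ x ∈ Metric.closedBall z ρ, ∑ k, ‖ξ k x‖ ^ 2 ≤ M)
    (hsuper : ∀ x ∈ Metric.closedBall z ρ,
      ∑ k, fderiv ℝ (fderiv ℝ u) x (ξ k x) (ξ k x) ≤ C * ‖fderiv ℝ u x‖)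
    (hyz : dist z y = 2 * ρ) (hpos : ∀ x ∈ Metric.closedBall y (2 * ρ), x ≠ z → 0 < u x) :
    0 < u z := by
  by_contra! hz
  obtain ⟨α, hα, hαbig⟩ : ∃ α : ℝ, 0 < α ∧ M + 3 * C * ρ < 2 * α * ρ ^ 2 := by
    refine ⟨(|M + 3 * C * ρ| + 1) / (2 * ρ ^ 2), by positivity, ?_⟩
    have : 2 * ((|M + 3 * C * ρ| + 1) / (2 * ρ ^ 2)) * ρ ^ 2 = |M + 3 * C * ρ| + 1 := by
      field_simp
    rw [this]
    linarith [le_abs_self (M + 3 * C * ρ)]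
  have hcont : ContinuousOn u (Metric.closedBall z ρ) := fun x hx =>
    (hu x hx).continuousAt.continuousWithinAt
  -- The point z is not on the sphere around it, so u is positive on this compact set and has a
  -- positive lower bound there.
  obtain ⟨ε, hε, hεu⟩ : ∃ ε : ℝ, 0 < ε ∧
      ∀ x ∈ Metric.sphere z ρ ∩ Metric.closedBall y (2 * ρ), ε ≤ u x := by
    have hK : IsCompact (Metric.sphere z ρ ∩ Metric.closedBall y (2 * ρ)) :=
      (isCompact_sphere z ρ).inter_right Metric.isClosed_closedBall
    rcases (Metric.sphere z ρ ∩ Metric.closedBall y (2 * ρ)).eq_empty_or_nonempty with h0 | hne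
    · exact ⟨1, one_pos, by simp [h0]⟩
    · obtain ⟨x, hx, hmin⟩ := hK.exists_isMinOn hne
        (hcont.mono (inter_subset_left.trans Metric.sphere_subset_closedBall))
      refine ⟨u x, hpos x hx.2 ?_, fun x' hx' => hmin hx'⟩
      rintro rfl
      have := hx.1
      simp at this
      linarith
  set v := barrier ε α (2 * ρ) y with hv
  have hvc : ContDiff ℝ 2 v := contDiff_barrier ..
  -- The minimum of u - v is at most its value at z, hence at most 0. On the sphere u > v, so q is
  -- interior: there Du = Dv and D²u ≥ D²v, against the strict subsolution property of v.
  obtain ⟨q, hq, hqmin⟩ := (isCompact_closedBall z ρ).exists_isMinOn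
    (Metric.nonempty_closedBall.2 hρ.le) (hcont.sub hvc.continuous.continuousOn)
  have hvz : v z = 0 := by
    simp [hv, barrier, ← dist_eq_norm, hyz]
  have hq0 : u q - v q ≤ 0 := by
    have : u q - v q ≤ u z - v z := hqmin (Metric.mem_closedBall_self hρ.le)
    linarith
  have hqball : q ∈ Metric.ball z ρ := by
    rcases (Metric.mem_closedBall.1 hq).lt_or_eq with h | h
    · exact h
    exfalso
    -- Inside the ball about y, v < ε ≤ u; outside it, v < 0 ≤ u.
    by_cases hqy : q ∈ Metric.closedBall y (2 * ρ)
    · have h1 := hεu q ⟨h, hqy⟩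
      have h2 : v q < ε := by
        have h3 : Real.exp (-α * ‖q - y‖ ^ 2) ≤ 1 := Real.exp_le_one_iff.2 (by
          have : 0 ≤ α * ‖q - y‖ ^ 2 := by positivity
          linarith)
        have h4 := Real.exp_pos (-α * (2 * ρ) ^ 2)
        simp only [hv, barrier]
        nlinarith
      linarith
    · have h1 := hnn q hq
      have h2 : v q < 0 := by
        simp only [Metric.mem_closedBall, not_le, dist_eq_norm] at hqy
        refine mul_neg_of_pos_of_neg hε (sub_neg.2 (Real.exp_lt_exp.2 ?_))
        have : (2 * ρ) ^ 2 < ‖q - y‖ ^ 2 := by gcongr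
        nlinarith
      linarith
  have hlocal : IsLocalMin (fun x => u x - v x) q :=
    hqmin.isLocalMin (Filter.mem_of_superset (Metric.isOpen_ball.mem_nhds hqball)
      Metric.ball_subset_closedBall)
  have huq := hu q hq
  have hfd : fderiv ℝ (fun x => u x - v x) =ᶠ[𝓝 q] fun x => fderiv ℝ u x - fderiv ℝ v x := by
    filter_upwards [huq.eventually (by simp)] with x hx
    exact fderiv_fun_sub (hx.differentiableAt (by simp)) (hvc.differentiable (by simp) x)
  have hgrad : fderiv ℝ u q = fderiv ℝ v q := by
    have := hlocal.fderiv_eq_zero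
    rw [hfd.eq_of_nhds] at this
    exact sub_eq_zero.1 this
  have hhess : ∀ k, fderiv ℝ (fderiv ℝ v) q (ξ k q) (ξ k q) ≤
      fderiv ℝ (fderiv ℝ u) q (ξ k q) (ξ k q) := fun k => by
    have := hessian_nonneg_of_isLocalMin (huq.sub hvc.contDiffAt) hlocal (ξ k q)
    rw [hfd.fderiv_eq, fderiv_fun_sub
      ((huq.fderiv_right (m := 1) (by norm_num)).differentiableAt (by simp))
      ((hvc.contDiffAt.fderiv_right (m := 1) (by norm_num)).differentiableAt (by simp))] at this
    simpa using this
  have hd1 : ρ ≤ ‖q - y‖ ∧ ‖q - y‖ ≤ 3 * ρ := by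
    rw [← dist_eq_norm]
    have h1 := dist_triangle z q y
    have h2 := dist_triangle q z y
    rw [dist_comm z q] at h1
    have := Metric.mem_closedBall.1 hq
    constructor <;> linarith
  have := barrier_subsolution (r := 2 * ρ) hε hα hρ hC y q (fun k => ξ k q) (hell q hq _)
    (hbd q hq) hd1.1 hd1.2 hαbig
  have h2 := hsuper q hq
  rw [hgrad] at h2
  have h3 := Finset.sum_le_sum fun k (_ : k ∈ Finset.univ) => hhess k
  linarith

/-- The strong maximum principle: a nonnegative supersolution with an interior zero vanishes
near that zero. -/
theorem supersolution_eventually_eq_zero [FiniteDimensional ℝ E] {ι : Type*} [Fintype ι]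
    {u : E → ℝ} {ξ : ι → E → E} {C M : ℝ} {x₀ : E} (hC : 0 ≤ C)
    (hu : ContDiffAt ℝ 2 u x₀) (hnn : ∀ᶠ x in 𝓝 x₀, 0 ≤ u x)
    (hell : ∀ᶠ x in 𝓝 x₀, ∀ v : E, ‖v‖ ^ 2 ≤ ∑ k, inner ℝ v (ξ k x) ^ 2)
    (hbd : ∀ᶠ x in 𝓝 x₀, ∑ k, ‖ξ k x‖ ^ 2 ≤ M)
    (hsuper : ∀ᶠ x in 𝓝 x₀,
      ∑ k, fderiv ℝ (fderiv ℝ u) x (ξ k x) (ξ k x) ≤ C * ‖fderiv ℝ u x‖)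
    (hzero : u x₀ = 0) : ∀ᶠ x in 𝓝 x₀, u x = 0 := by
  obtain ⟨R, hR, hball⟩ := Metric.eventually_nhds_iff_ball.1
    ((hu.eventually (by simp)).and (hnn.and (hell.and (hbd.and hsuper))))
  refine Metric.eventually_nhds_iff_ball.2 ⟨R / 3, by positivity, fun y hy => ?_⟩
  rw [Metric.mem_ball] at hy
  by_contra hne
  have hsub : Metric.closedBall x₀ (2 * R / 3) ⊆ Metric.ball x₀ R :=
    Metric.closedBall_subset_ball (by linarith)
  have hcont : ContinuousOn u (Metric.closedBall x₀ (2 * R / 3)) := fun x hx =>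
    (hball x (hsub hx)).1.continuousAt.continuousWithinAt
  have hZ : IsCompact (Metric.closedBall x₀ (2 * R / 3) ∩ u ⁻¹' {0}) :=
    (isCompact_closedBall x₀ (2 * R / 3)).of_isClosed_subset
      (hcont.preimage_isClosed_of_isClosed Metric.isClosed_closedBall isClosed_singleton)
      inter_subset_left
  have hx₀ : x₀ ∈ Metric.closedBall x₀ (2 * R / 3) ∩ u ⁻¹' {0} :=
    ⟨Metric.mem_closedBall_self (by positivity), hzero⟩
  -- With z a zero nearest to y, the open ball of radius r about y contains no zero.
  obtain ⟨z, hzZ, hzmin⟩ := hZ.exists_infDist_eq_dist ⟨x₀, hx₀⟩ y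
  have hz0 : u z = 0 := hzZ.2
  set r := dist y z with hr
  have hrpos : 0 < r := dist_pos.2 fun h => hne (h ▸ hz0)
  have hrle : r < R / 3 := by
    have := Metric.infDist_le_dist_of_mem (x := y) hx₀
    linarith
  have hposball : ∀ x, dist y x < r → 0 < u x := fun x hx => by
    have hxR : x ∈ Metric.closedBall x₀ (2 * R / 3) := by
      have := dist_triangle x y x₀
      rw [dist_comm x y] at this
      exact Metric.mem_closedBall.2 (by linarith)
    refine lt_of_le_of_ne (hball x (hsub hxR)).2.1 fun h => ?_
    have hxZ : x ∈ Metric.closedBall x₀ (2 * R / 3) ∩ u ⁻¹' {0} := ⟨hxR, h.symm⟩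
    have := Metric.infDist_le_dist_of_mem (x := y) hxZ
    linarith
  have hin : ∀ x ∈ Metric.closedBall z (r / 4), x ∈ Metric.ball x₀ R := fun x hx => by
    have h1 := dist_triangle x z x₀
    have h2 := dist_triangle z y x₀
    rw [dist_comm z y] at h2
    have := Metric.mem_closedBall.1 hx
    exact Metric.mem_ball.2 (by linarith)
  -- The ball about y may touch the zero set at several points. The ball of half the radius centred
  -- at the midpoint of y and z meets the larger sphere only at z.
  have hmz : dist z (midpoint ℝ y z) = r / 2 := by
    rw [dist_right_midpoint]; simp [hr]; ring
  have hmy : dist y (midpoint ℝ y z) = r / 2 := by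
    rw [dist_left_midpoint]; simp [hr]; ring
  refine (supersolution_pos_of_touching_ball (y := midpoint ℝ y z) (z := z) (ρ := r / 4)
    (by positivity) hC (fun x hx => (hball x (hin x hx)).1) (fun x hx => (hball x (hin x hx)).2.1)
    (fun x hx => (hball x (hin x hx)).2.2.1) (fun x hx => (hball x (hin x hx)).2.2.2.1)
    (fun x hx => (hball x (hin x hx)).2.2.2.2) (by linarith) fun x hx hxz => ?_).ne' hz0
  have hxm : dist (midpoint ℝ y z) x ≤ r / 2 := by
    rw [dist_comm]; linarith [Metric.mem_closedBall.1 hx]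
  refine hposball x (lt_of_le_of_ne ?_ fun h => hxz ?_)
  · linarith [dist_triangle y (midpoint ℝ y z) x]
  · have hmx : dist (midpoint ℝ y z) x = r / 2 :=
      le_antisymm hxm (by linarith [dist_triangle y (midpoint ℝ y z) x])
    have := eq_midpoint_of_dist_eq_half (x := y) (y := midpoint ℝ y z) (z := x)
      (by rw [h, hmy]) (by rw [h, hmx])
    have := (midpoint_eq_midpoint_iff_vsub_eq_vsub ℝ).1 this
    simpa [sub_eq_zero, eq_comm] using this

end MaximumPrinciple

/-! ### The mean curvature equation of a graph -/

section GraphGeometry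

theorem partialDeriv_euclidean_three {a b c : Plane → ℝ} {x : Plane} (i : Fin 2)
    (ha : DifferentiableAt ℝ a x) (hb : DifferentiableAt ℝ b x) (hc : DifferentiableAt ℝ c x) :
    partialDeriv i (fun y => (!₂[a y, b y, c y] : Space)) x =
      !₂[partialDeriv i a x, partialDeriv i b x, partialDeriv i c x] := by
  have h : HasFDerivAt (fun y => (!₂[a y, b y, c y] : Space))
      (fderiv ℝ (fun y => (!₂[a y, b y, c y] : Space)) x) x := by
    refine DifferentiableAt.hasFDerivAt (differentiableAt_euclidean.2 fun k => ?_)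
    fin_cases k
    exacts [ha, hb, hc]
  ext k
  have hk := congrArg (fun A : Plane →L[ℝ] ℝ => A (EuclideanSpace.single i 1)) 
    ((EuclideanSpace.proj k : Space →L[ℝ] ℝ).hasFDerivAt.comp x h).fderiv
  fin_cases k
  exacts [hk.symm, hk.symm, hk.symm]

theorem partialDeriv_coord (i j : Fin 2) (x : Plane) :
    partialDeriv i (fun y : Plane => y j) x = if j = i then 1 else 0 := by
  have : HasFDerivAt (fun y : Plane => y j) (EuclideanSpace.proj j : Plane →L[ℝ] ℝ) x :=
    (EuclideanSpace.proj j : Plane →L[ℝ] ℝ).hasFDerivAt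
  rw [partialDeriv, this.fderiv]
  simp

theorem partialDeriv_const {E : Type*} [NormedAddCommGroup E] [NormedSpace ℝ E] (i : Fin 2) (c : E)
    (x : Plane) : partialDeriv i (fun _ => c) x = 0 := by
  simp [partialDeriv]

theorem partialDeriv_graphMap {f : Plane → ℝ} {x : Plane} (i : Fin 2)
    (hf : DifferentiableAt ℝ f x) :
    partialDeriv i (graphMap f) x =
      !₂[if 0 = i then 1 else 0, if 1 = i then 1 else 0, partialDeriv i f x] := by
  have hcoord (j : Fin 2) : DifferentiableAt ℝ (fun y : Plane => y j) x :=
    (EuclideanSpace.proj j : Plane →L[ℝ] ℝ).differentiableAt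
  rw [← partialDeriv_coord i 0 x, ← partialDeriv_coord i 1 x]
  exact partialDeriv_euclidean_three i (hcoord 0) (hcoord 1) hf

theorem partialDeriv_partialDeriv {f : Plane → ℝ} {x : Plane} (i j : Fin 2)
    (hf : ContDiffAt ℝ 2 f x) :
    partialDeriv j (partialDeriv i f) x =
      fderiv ℝ (fderiv ℝ f) x (EuclideanSpace.single j 1) (EuclideanSpace.single i 1) := by
  have hd : DifferentiableAt ℝ (fderiv ℝ f) x :=
    (hf.fderiv_right (m := 1) (by norm_num)).differentiableAt (by simp)
  have := hd.hasFDerivAt.clm_apply (hasFDerivAt_const (EuclideanSpace.single i (1 : ℝ)) x)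
  exact (congrArg (fun A : Plane →L[ℝ] ℝ => A (EuclideanSpace.single j 1)) this.fderiv).trans
    (by simp)

theorem partialDeriv_partialDeriv_graphMap {f : Plane → ℝ} {x : Plane} (i j : Fin 2)
    (hf : ContDiffAt ℝ 2 f x) :
    partialDeriv j (partialDeriv i (graphMap f)) x =
      !₂[0, 0, partialDeriv j (partialDeriv i f) x] := by
  have h : partialDeriv i (graphMap f) =ᶠ[𝓝 x] fun y =>
      !₂[if 0 = i then 1 else 0, if 1 = i then 1 else 0, partialDeriv i f y] := by
    filter_upwards [hf.eventually (by simp)] with y hy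
    exact partialDeriv_graphMap i (hy.differentiableAt (by simp))
  have hd : DifferentiableAt ℝ (partialDeriv i f) x :=
    ((hf.fderiv_right (m := 1) (by norm_num)).differentiableAt (by simp)).clm_apply
      (differentiableAt_const _)
  rw [partialDeriv, h.fderiv_eq, ← partialDeriv, partialDeriv_euclidean_three j
    (differentiableAt_const _) (differentiableAt_const _) hd, partialDeriv_const,
    partialDeriv_const]

/-- The gradient vector of a covector, rotated by a right angle. -/
noncomputable def rotatedGradient (A : Plane →L[ℝ] ℝ) : Plane :=
  A (EuclideanSpace.single 1 1) • EuclideanSpace.single 0 1 -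
    A (EuclideanSpace.single 0 1) • EuclideanSpace.single 1 1

theorem rotatedGradient_sub (A B : Plane →L[ℝ] ℝ) :
    rotatedGradient (A - B) = rotatedGradient A - rotatedGradient B := by
  simp only [rotatedGradient, _root_.sub_apply, sub_smul]
  abel

theorem norm_rotatedGradient_le (A : Plane →L[ℝ] ℝ) : ‖rotatedGradient A‖ ≤ 2 * ‖A‖ := by
  have h (i : Fin 2) : ‖A (EuclideanSpace.single i 1)‖ ≤ ‖A‖ := by
    simpa using A.le_opNorm (EuclideanSpace.single i (1 : ℝ))
  refine (norm_sub_le _ _).trans ?_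
  simp only [norm_smul, PiLp.norm_single, norm_one, mul_one]
  linarith [h 0, h 1]

theorem norm_rotatedGradient_sq (A : Plane →L[ℝ] ℝ) :
    ‖rotatedGradient A‖ ^ 2 =
      A (EuclideanSpace.single 0 1) ^ 2 + A (EuclideanSpace.single 1 1) ^ 2 := by
  simp [EuclideanSpace.norm_sq_eq, rotatedGradient]
  ring

/-- The area element of the graph of a function with rotated gradient `ν`. -/
noncomputable def areaElement (ν : Plane) : ℝ := Real.sqrt (1 + ‖ν‖ ^ 2)

theorem areaElement_sq (ν : Plane) : areaElement ν ^ 2 = 1 + ‖ν‖ ^ 2 :=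
  Real.sq_sqrt (by positivity)

theorem one_le_areaElement (ν : Plane) : 1 ≤ areaElement ν :=
  Real.one_le_sqrt.2 (by linarith [sq_nonneg ‖ν‖])

/-- The quasilinear form of the mean curvature equation of a graph. -/
theorem meanCurvature_graph_equation {f : Plane → ℝ} {x : Plane} (hf : ContDiffAt ℝ 2 f x) :
    fderiv ℝ (fderiv ℝ f) x (EuclideanSpace.single 0 1) (EuclideanSpace.single 0 1) +
      fderiv ℝ (fderiv ℝ f) x (EuclideanSpace.single 1 1) (EuclideanSpace.single 1 1) +
      fderiv ℝ (fderiv ℝ f) x (rotatedGradient (fderiv ℝ f x)) (rotatedGradient (fderiv ℝ f x)) =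
    2 * meanCurvature (graphMap f) (upwardNormal f) x *
      areaElement (rotatedGradient (fderiv ℝ f x)) ^ 3 := by
  have hd : DifferentiableAt ℝ f x := hf.differentiableAt (by simp)
  have hW : Real.sqrt (1 + partialDeriv 0 f x ^ 2 + partialDeriv 1 f x ^ 2) =
      areaElement (rotatedGradient (fderiv ℝ f x)) := by
    rw [areaElement, norm_rotatedGradient_sq, ← add_assoc]; rfl
  have hsq := areaElement_sq (rotatedGradient (fderiv ℝ f x))
  rw [norm_rotatedGradient_sq] at hsq
  have hpos := one_le_areaElement (rotatedGradient (fderiv ℝ f x))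
  have hg : firstFundamentalForm (graphMap f) x =
      !![1 + partialDeriv 0 f x ^ 2, partialDeriv 0 f x * partialDeriv 1 f x;
        partialDeriv 0 f x * partialDeriv 1 f x, 1 + partialDeriv 1 f x ^ 2] := by
    ext i j
    fin_cases i <;> fin_cases j <;>
      simp [firstFundamentalForm, partialDeriv_graphMap _ hd, PiLp.inner_apply,
        Fin.sum_univ_three] <;> ring
  have hb (i j : Fin 2) : secondFundamentalForm (graphMap f) (upwardNormal f) x i j =
      (areaElement (rotatedGradient (fderiv ℝ f x)))⁻¹ *
        fderiv ℝ (fderiv ℝ f) x (EuclideanSpace.single j 1) (EuclideanSpace.single i 1) := by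
    simp [secondFundamentalForm, partialDeriv_partialDeriv_graphMap _ _ hf, upwardNormal, hW,
      PiLp.inner_apply, Fin.sum_univ_three, partialDeriv_partialDeriv _ _ hf]
  have hdet : (firstFundamentalForm (graphMap f) x).det =
      areaElement (rotatedGradient (fderiv ℝ f x)) ^ 2 := by
    rw [hg, Matrix.det_fin_two_of, hsq]; simp only [partialDeriv]; ring
  rw [meanCurvature, shapeOperator, Matrix.inv_def, hdet, hg, Matrix.adjugate_fin_two_of,
    Ring.inverse_eq_inv', Matrix.trace_fin_two]
  simp only [Matrix.smul_apply, Matrix.mul_apply, Fin.sum_univ_two, hb]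
  simp only [rotatedGradient] at hsq hpos ⊢
  simp only [partialDeriv, map_sub, map_smul, _root_.sub_apply,
    _root_.smul_apply, smul_eq_mul, Matrix.of_apply, Matrix.cons_val', Matrix.cons_val_zero,
    Matrix.cons_val_one, Matrix.cons_val_fin_one]
  -- The determinant contributes W⁻² and the unit normal W⁻¹, cancelling W³. Both mixed derivatives
  -- occur on each side, so symmetry of the Hessian is not needed.
  field_simp
  ring

/-- Since a² - b² = |ν₁|² - |ν₂|² and a + b ≥ 1, W is Lipschitz with constant 2K; the cofactor a² +
ab + b² is at most 3(1 + K²). -/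
theorem abs_areaElement_cube_sub_le {K : ℝ} {ν₁ ν₂ : Plane} (h₁ : ‖ν₁‖ ≤ K) (h₂ : ‖ν₂‖ ≤ K) :
    |areaElement ν₁ ^ 3 - areaElement ν₂ ^ 3| ≤ 6 * K * (1 + K ^ 2) * ‖ν₁ - ν₂‖ := by
  have hK : 0 ≤ K := (norm_nonneg _).trans h₁
  have hs₁ := areaElement_sq ν₁
  have hs₂ := areaElement_sq ν₂
  have ho₁ := one_le_areaElement ν₁
  have ho₂ := one_le_areaElement ν₂
  set a := areaElement ν₁
  set b := areaElement ν₂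
  have ha : a ^ 2 ≤ 1 + K ^ 2 := by rw [hs₁]; gcongr
  have hb : b ^ 2 ≤ 1 + K ^ 2 := by rw [hs₂]; gcongr
  have hdiff : |a - b| ≤ 2 * K * ‖ν₁ - ν₂‖ := by
    have h1 : |a - b| * (a + b) = |‖ν₁‖ - ‖ν₂‖| * (‖ν₁‖ + ‖ν₂‖) := by
      have h : (a - b) * (a + b) = (‖ν₁‖ - ‖ν₂‖) * (‖ν₁‖ + ‖ν₂‖) := by
        linear_combination hs₁ - hs₂
      have := congrArg abs h
      rwa [abs_mul, abs_mul, abs_of_nonneg (show 0 ≤ a + b by linarith),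
        abs_of_nonneg (show 0 ≤ ‖ν₁‖ + ‖ν₂‖ by positivity)] at this
    have h2 : |a - b| ≤ |a - b| * (a + b) := le_mul_of_one_le_right (abs_nonneg _) (by linarith)
    have h3 : |‖ν₁‖ - ‖ν₂‖| * (‖ν₁‖ + ‖ν₂‖) ≤ ‖ν₁ - ν₂‖ * (K + K) :=
      mul_le_mul (abs_norm_sub_norm_le _ _) (by linarith) (by positivity) (norm_nonneg _)
    linarith
  have hq : a ^ 2 + a * b + b ^ 2 ≤ 3 * (1 + K ^ 2) := by nlinarith [sq_nonneg (a - b)]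
  rw [show a ^ 3 - b ^ 3 = (a - b) * (a ^ 2 + a * b + b ^ 2) by ring, abs_mul,
    abs_of_nonneg (show 0 ≤ a ^ 2 + a * b + b ^ 2 by positivity)]
  calc |a - b| * (a ^ 2 + a * b + b ^ 2) ≤ (2 * K * ‖ν₁ - ν₂‖) * (3 * (1 + K ^ 2)) := by gcongr
    _ = _ := by ring

theorem abs_bilin_diag_sub_le {E : Type*} [NormedAddCommGroup E] [NormedSpace ℝ E] {K L : ℝ}
    (B : E →L[ℝ] E →L[ℝ] ℝ) {v w : E} (hB : ‖B‖ ≤ L) (hv : ‖v‖ ≤ K) (hw : ‖w‖ ≤ K) :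
    |B w w - B v v| ≤ 2 * L * K * ‖v - w‖ := by
  have hL : 0 ≤ L := B.opNorm_nonneg.trans hB
  have h1 : ‖B (v - w) w‖ ≤ L * ‖v - w‖ * K := (B.le_opNorm₂ _ _).trans (by gcongr)
  have h2 : ‖B v (v - w)‖ ≤ L * K * ‖v - w‖ := (B.le_opNorm₂ _ _).trans (by gcongr)
  have h3 : B w w - B v v = -(B (v - w) w + B v (v - w)) := by
    simp only [map_sub, _root_.sub_apply]; ring
  rw [h3, abs_neg]
  refine (abs_add_le _ _).trans ?_
  rw [Real.norm_eq_abs] at h1 h2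
  linarith

/-- The directions in which the second derivatives of the mean curvature operator at a function
with derivative `A` are taken. -/
noncomputable def curvatureFrame (A : Plane →L[ℝ] ℝ) : Fin 3 → Plane :=
  ![EuclideanSpace.single 0 1, EuclideanSpace.single 1 1, rotatedGradient A]

/-- The first two directions are an orthonormal basis; the third only adds a square. -/
theorem norm_sq_le_sum_inner_curvatureFrame (A : Plane →L[ℝ] ℝ) (v : Plane) :
    ‖v‖ ^ 2 ≤ ∑ k, inner ℝ v (curvatureFrame A k) ^ 2 := by
  simp only [Fin.sum_univ_three, curvatureFrame, Matrix.cons_val]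
  rw [EuclideanSpace.norm_sq_eq, Fin.sum_univ_two]
  simp [EuclideanSpace.inner_single_right]
  positivity

theorem sum_norm_sq_curvatureFrame_le {A : Plane →L[ℝ] ℝ} {K : ℝ} (hA : ‖rotatedGradient A‖ ≤ K) :
    ∑ k, ‖curvatureFrame A k‖ ^ 2 ≤ 2 + K ^ 2 := by
  simp only [Fin.sum_univ_three, curvatureFrame, Matrix.cons_val, PiLp.norm_single,
    norm_one]
  have : ‖rotatedGradient A‖ ^ 2 ≤ K ^ 2 := by gcongr
  linarith

/-- The difference of two graphs of the same mean curvature satisfies a linear elliptic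
differential inequality. -/
theorem curvature_difference_le {f₁ f₂ : Plane → ℝ} {x : Plane} {H K L : ℝ}
    (h₁ : ContDiffAt ℝ 2 f₁ x) (h₂ : ContDiffAt ℝ 2 f₂ x)
    (hH₁ : meanCurvature (graphMap f₁) (upwardNormal f₁) x = H)
    (hH₂ : meanCurvature (graphMap f₂) (upwardNormal f₂) x = H)
    (hK₁ : ‖rotatedGradient (fderiv ℝ f₁ x)‖ ≤ K) (hK₂ : ‖rotatedGradient (fderiv ℝ f₂ x)‖ ≤ K)
    (hL : ‖fderiv ℝ (fderiv ℝ f₂) x‖ ≤ L) :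
    ∑ k, fderiv ℝ (fderiv ℝ fun y => f₁ y - f₂ y) x (curvatureFrame (fderiv ℝ f₁ x) k)
        (curvatureFrame (fderiv ℝ f₁ x) k) ≤
      (2 * (12 * |H| * K * (1 + K ^ 2) + 2 * L * K)) * ‖fderiv ℝ (fun y => f₁ y - f₂ y) x‖ := by
  have hfd : fderiv ℝ (fun y => f₁ y - f₂ y) =ᶠ[𝓝 x] fun y => fderiv ℝ f₁ y - fderiv ℝ f₂ y := by
    filter_upwards [h₁.eventually (by simp), h₂.eventually (by simp)] with y hy₁ hy₂
    exact fderiv_fun_sub (hy₁.differentiableAt (by simp)) (hy₂.differentiableAt (by simp))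
  have hhess : fderiv ℝ (fderiv ℝ fun y => f₁ y - f₂ y) x =
      fderiv ℝ (fderiv ℝ f₁) x - fderiv ℝ (fderiv ℝ f₂) x := by
    rw [hfd.fderiv_eq]
    exact fderiv_fun_sub ((h₁.fderiv_right (m := 1) (by norm_num)).differentiableAt (by simp))
      ((h₂.fderiv_right (m := 1) (by norm_num)).differentiableAt (by simp))
  have hK : 0 ≤ K := (norm_nonneg _).trans hK₁
  have hL0 : 0 ≤ L := (fderiv ℝ (fderiv ℝ f₂) x).opNorm_nonneg.trans hL
  have e₁ := meanCurvature_graph_equation h₁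
  have e₂ := meanCurvature_graph_equation h₂
  rw [hH₁] at e₁
  rw [hH₂] at e₂
  have hν : ‖rotatedGradient (fderiv ℝ f₁ x) - rotatedGradient (fderiv ℝ f₂ x)‖ ≤
      2 * ‖fderiv ℝ (fun y => f₁ y - f₂ y) x‖ := by
    rw [← rotatedGradient_sub, hfd.eq_of_nhds]
    exact norm_rotatedGradient_le _
  have hW := abs_areaElement_cube_sub_le hK₁ hK₂
  have hB := abs_bilin_diag_sub_le (fderiv ℝ (fderiv ℝ f₂) x) hL hK₁ hK₂
  have hHW : 2 * H * (areaElement (rotatedGradient (fderiv ℝ f₁ x)) ^ 3 -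
      areaElement (rotatedGradient (fderiv ℝ f₂ x)) ^ 3) ≤ 2 * |H| * (6 * K * (1 + K ^ 2) *
        ‖rotatedGradient (fderiv ℝ f₁ x) - rotatedGradient (fderiv ℝ f₂ x)‖) := by
    refine (le_abs_self _).trans ?_
    rw [abs_mul, abs_mul, abs_two]
    gcongr
  have hfin := mul_le_mul_of_nonneg_left hν
    (show 0 ≤ 12 * |H| * K * (1 + K ^ 2) + 2 * L * K by positivity)
  simp only [hhess, Fin.sum_univ_three, curvatureFrame, Matrix.cons_val,
    _root_.sub_apply]
  -- D²w is evaluated at ν₁, but the equation for f₂ involves ν₂; this term is the resulting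
  -- discrepancy, bounded by `hB`.
  linarith [le_abs_self (fderiv ℝ (fderiv ℝ f₂) x (rotatedGradient (fderiv ℝ f₂ x))
    (rotatedGradient (fderiv ℝ f₂ x)) - fderiv ℝ (fderiv ℝ f₂) x (rotatedGradient (fderiv ℝ f₁ x))
    (rotatedGradient (fderiv ℝ f₁ x)))]

end GraphGeometry

/-! ### Local coincidence of the graphs -/

theorem eventually_norm_le_of_continuousAt {X E : Type*} [TopologicalSpace X]
    [SeminormedAddCommGroup E] {g : X → E} {x : X} (hg : ContinuousAt g x) :
    ∀ᶠ y in 𝓝 x, ‖g y‖ ≤ ‖g x‖ + 1 :=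
  (hg.norm.eventually_lt_const (lt_add_one _)).mono fun _ h => h.le

theorem IsCMCGraph.contDiffAt {D : Set Plane} {H : ℝ} {f : Plane → ℝ} (h : IsCMCGraph D H f)
    {x : Plane} (hx : x ∈ interior (closure D)) : ContDiffAt ℝ 2 f x :=
  contDiffAt_infty.1 (h.smooth.contDiffAt (mem_interior_iff_mem_nhds.1 hx)) 2

/-- Two graphs of the same constant mean curvature, one above the other, agree near an interior
point of contact. -/
theorem eventually_eq_of_touching {D : Set Plane} {H : ℝ} {f₁ f₂ : Plane → ℝ}
    (h₁ : IsCMCGraph D H f₁) (h₂ : IsCMCGraph D H f₂) (habove : LiesAbove D f₁ f₂) {x : Plane}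
    (hx : x ∈ interior (closure D)) (heq : f₁ x = f₂ x) : ∀ᶠ y in 𝓝 x, f₁ y = f₂ y := by
  have hint : ∀ᶠ y in 𝓝 x, y ∈ interior (closure D) := isOpen_interior.mem_nhds hx
  have hc {f : Plane → ℝ} (h : IsCMCGraph D H f) : ContinuousAt (fderiv ℝ f) x :=
    ((h.contDiffAt hx).fderiv_right (m := 1) (by norm_num)).continuousAt
  have hc2 : ContinuousAt (fderiv ℝ (fderiv ℝ f₂)) x :=
    (((h₂.contDiffAt hx).fderiv_right (m := 1) (by norm_num)).fderiv_right
      (m := 0) (by norm_num)).continuousAt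
  -- The factor 2 comes from `norm_rotatedGradient_le`; the added 1 leaves room for the gradients to
  -- vary near x.
  set K := 2 * (max ‖fderiv ℝ f₁ x‖ ‖fderiv ℝ f₂ x‖ + 1) with hK
  have hK₁ : ∀ᶠ y in 𝓝 x, ‖rotatedGradient (fderiv ℝ f₁ y)‖ ≤ K :=
    (eventually_norm_le_of_continuousAt (hc h₁)).mono fun y hy =>
      (norm_rotatedGradient_le _).trans
        (by linarith [le_max_left ‖fderiv ℝ f₁ x‖ ‖fderiv ℝ f₂ x‖])
  have hK₂ : ∀ᶠ y in 𝓝 x, ‖rotatedGradient (fderiv ℝ f₂ y)‖ ≤ K :=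
    (eventually_norm_le_of_continuousAt (hc h₂)).mono fun y hy =>
      (norm_rotatedGradient_le _).trans
        (by linarith [le_max_right ‖fderiv ℝ f₁ x‖ ‖fderiv ℝ f₂ x‖])
  have hL := eventually_norm_le_of_continuousAt (E := Plane →L[ℝ] Plane →L[ℝ] ℝ) hc2
  have key : ∀ᶠ y in 𝓝 x, f₁ y - f₂ y = 0 := by
    refine supersolution_eventually_eq_zero (ξ := fun k y => curvatureFrame (fderiv ℝ f₁ y) k)
      (C := 2 * (12 * |H| * K * (1 + K ^ 2) + 2 * (‖fderiv ℝ (fderiv ℝ f₂) x‖ + 1) * K))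
      (M := 2 + K ^ 2) (by positivity) ((h₁.contDiffAt hx).sub (h₂.contDiffAt hx)) ?_ ?_ ?_ ?_ ?_
    · filter_upwards [hint] with y hy using sub_nonneg.2 (habove y (interior_subset hy))
    · exact .of_forall fun y => norm_sq_le_sum_inner_curvatureFrame _
    · exact hK₁.mono fun y => sum_norm_sq_curvatureFrame_le
    · filter_upwards [hint, hK₁, hK₂, hL] with y hy hy₁ hy₂ hyL
      exact curvature_difference_le (h₁.contDiffAt hy) (h₂.contDiffAt hy)
        (h₁.meanCurvature_eq y hy) (h₂.meanCurvature_eq y hy) hy₁ hy₂ hyL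
    · exact sub_eq_zero.2 heq
  exact key.mono fun y => sub_eq_zero.1

theorem graphMap_mem_cylinder_iff (f : Plane → ℝ) (V : Set Plane) (y : Plane) :
    graphMap f y ∈ (fun q : Space => (!₂[q 0, q 1] : Plane)) ⁻¹' V ↔ y ∈ V := by
  have : (!₂[(graphMap f y) 0, (graphMap f y) 1] : Plane) = y := by
    ext i; fin_cases i <;> rfl
  rw [mem_preimage, this]

end CMCGraph

theorem mainTheorem11 (D : Set CMCGraph.Plane) (hDopen : IsOpen D)
    (hDbdd : Bornology.IsBounded D) (H : ℝ) (f₁ f₂ : CMCGraph.Plane → ℝ)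
    (h₁ : CMCGraph.IsCMCGraph D H f₁) (h₂ : CMCGraph.IsCMCGraph D H f₂)
    (habove : CMCGraph.LiesAbove D f₁ f₂) (p : CMCGraph.Space)
    (hp : CMCGraph.IsInteriorCommonTangency D f₁ f₂ p) :
    ∃ U : Set CMCGraph.Space, IsOpen U ∧ p ∈ U ∧
      CMCGraph.graphSurface D f₁ ∩ U = CMCGraph.graphSurface D f₂ ∩ U := by
  obtain ⟨x, hx, hp₁, hp₂⟩ := hp
  have heq : f₁ x = f₂ x := congrArg (fun q : CMCGraph.Space => q 2) (hp₁.symm.trans hp₂)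
  obtain ⟨V, hV, hVopen, hxV⟩ := eventually_nhds_iff.1
    (CMCGraph.eventually_eq_of_touching h₁ h₂ habove hx heq)
  have hg : ∀ y ∈ V, CMCGraph.graphMap f₁ y = CMCGraph.graphMap f₂ y := fun y hy => by
    simp only [CMCGraph.graphMap, hV y hy]
  -- U is the full vertical cylinder over V: a graph point lies in it exactly when its base point
  -- lies in V, where f₁ = f₂.
  refine ⟨(fun q : CMCGraph.Space => (!₂[q 0, q 1] : CMCGraph.Plane)) ⁻¹' V,
    hVopen.preimage (by fun_prop), hp₁ ▸ (CMCGraph.graphMap_mem_cylinder_iff f₁ V x).2 hxV, ?_⟩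
  apply Subset.antisymm
  · rintro _ ⟨⟨y, hy, rfl⟩, hyU⟩
    exact ⟨⟨y, hy, (hg y ((CMCGraph.graphMap_mem_cylinder_iff f₁ V y).1 hyU)).symm⟩, hyU⟩
  · rintro _ ⟨⟨y, hy, rfl⟩, hyU⟩
    exact ⟨⟨y, hy, hg y ((CMCGraph.graphMap_mem_cylinder_iff f₂ V y).1 hyU)⟩, hyU⟩
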